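/- Let $k$ be an algebraically closed field, and let $R = k[x,y,z,w]$ be bigraded by giving $x,y$ degree $(1,0)$ and $z,w$ degree $(0,1)$; write $R_{a,b}$ for the piece of degree $(a,b)\in\mathbb{Z}^2$ (zero if $a<0$ or $b<0$). Let $p_0,p_1,p_2\in R_{2,1}$ have no common zeros on $\mathbb{P}^1\times\mathbb{P}^1$. Let $\mathrm{Syz}(p)$ be the kernel of $R(-2,-1)^3\to R$, $(A_0,A_1,A_2)\mapsto A_0p_0+A_1p_1+A_2p_2$, so that $\mathrm{Syz}(p)_{m,n}$ consists of the syzygies with $A_0,A_1,A_2\in R_{m-2,n-1}$, and let $H_{\mathrm{Syz}(p)}(m,n)=\dim_k \mathrm{Syz}(p)_{m,n}$ for $m,n\in\mathbb{Z}$ (these dimensions are finite). Let $W(p)=\mathbb{P}(\mathrm{Span}(p_0,p_1,p_2))\subset\mathbb{P}(R_{2,1})$, and let $Y\subset\mathbb{P}(R_{2,1})$ be the image of the Segre embedding $\mathbb{P}(R_{2,0})\times\mathbb{P}(R_{0,1})\to\mathbb{P}(R_{2,1})$ given by multiplication. Call $p_0,p_1,p_2$ generic if $W(p)\cap Y$ is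 finite, and non-generic if it is infinite. **Proposition 5.1.** (1) In the generic case, for all $m,n\in\mathbb{Z}$, $$H_{\mathrm{Syz}(p)}(m,n)=\begin{cases}3(m-3)(n-1)-(m-5)(n-2) & m\ge 5,\ n\ge 2\\ m-5 & m\ge 6,\ n=1\\ 2(n-2) & m=3,\ n\ge 3\\ 3(n-1)+(n-2) & m=4,\ n\ge 2\\ 0 & \text{otherwise.}\end{cases}$$ (2) In the non-generic case, for all $m,n\in\mathbb{Z}$, $$H_{\mathrm{Syz}(p)}(m,n)=\begin{cases}3(m-3)(n-1)-(m-5)(n-2) & m\ge 5,\ n\ge 2\\ m-5 & m\ge 6,\ n=1\\ (m-1)(n-2) & m=2,3,\ n\ge 3\\ 3(n-1)+(n-2) & m=4,\ n\ge 2\\ 0 & \text{otherwise.}\end{cases}$$ -/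

import Mathlib

open MvPolynomial
open scoped LinearAlgebra.Projectivization

namespace BigradedSyzygy

/-- The bidegrees of the variables `x = X 0`, `y = X 1`, `z = X 2`, `w = X 3`:
`x, y` have degree `(1, 0)` and `z, w` have degree `(0, 1)`. -/
def bidegree : Fin 4 → ℤ × ℤ := ![(1, 0), (1, 0), (0, 1), (0, 1)]

/-- The graded piece `R_{m,n}` of `R = k[x, y, z, w]`, for `m n : ℤ`
(it is zero as soon as `m` or `n` is negative). -/
noncomputable def piece (k : Type*) [Field k] (m n : ℤ) :
    Submodule k (MvPolynomial (Fin 4) k) :=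
  weightedHomogeneousSubmodule k bidegree (m, n)

/-- `p₀, p₁, p₂` have no common zeros on `ℙ¹ × ℙ¹`: a point is given by a pair of nonzero vectors
of homogeneous coordinates `(u₀ : u₁)`, `(v₀ : v₁)`. -/
def NoCommonZeros {k : Type*} [Field k] (p : Fin 3 → MvPolynomial (Fin 4) k) : Prop :=
  ∀ u v : Fin 2 → k, u ≠ 0 → v ≠ 0 → ∃ i, eval ![u 0, u 1, v 0, v 1] (p i) ≠ 0

/-- The syzygy module `Syz(p)`: the kernel of `R³ → R`, `(A₀, A₁, A₂) ↦ A₀ p₀ + A₁ p₁ + A₂ p₂`. -/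
noncomputable def syz {k : Type*} [Field k] (p : Fin 3 → MvPolynomial (Fin 4) k) :
    Submodule (MvPolynomial (Fin 4) k) (Fin 3 → MvPolynomial (Fin 4) k) :=
  LinearMap.ker (Fintype.linearCombination (MvPolynomial (Fin 4) k) p)

/-- The graded piece `Syz(p)_{m,n}`. Here `Syz(p)` is graded as a submodule of `R(-2,-1)³`, whose
piece of degree `(m, n)` is `(R_{m-2,n-1})³`. -/
noncomputable def syzPiece {k : Type*} [Field k] (p : Fin 3 → MvPolynomial (Fin 4) k) (m n : ℤ) :
    Submodule k (Fin 3 → MvPolynomial (Fin 4) k) :=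
  (syz p).restrictScalars k ⊓ Submodule.pi Set.univ (fun _ => piece k (m - 2) (n - 1))

/-- The Hilbert function of a bigraded module with graded pieces `M m n`. -/
noncomputable def hilbert {k V : Type*} [Field k] [AddCommGroup V] [Module k V]
    (M : ℤ → ℤ → Submodule k V) (m n : ℤ) : ℕ :=
  Module.finrank k (M m n)

/-- `W(p) = ℙ(Span(p₀, p₁, p₂))` inside `ℙ(R_{2,1})`. -/
def planeW {k : Type*} [Field k] (p : Fin 3 → MvPolynomial (Fin 4) k) : Set (ℙ k (piece k 2 1)) :=
  {P | (P.rep : MvPolynomial (Fin 4) k) ∈ Submodule.span k (Set.range p)}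

/-- `Y ⊆ ℙ(R_{2,1})`, the image of the Segre embedding `ℙ(R_{2,0}) × ℙ(R_{0,1}) → ℙ(R_{2,1})`
given by multiplication (the factors are nonzero since `P.rep` is). -/
def segreY (k : Type*) [Field k] : Set (ℙ k (piece k 2 1)) :=
  {P | ∃ q ∈ piece k 2 0, ∃ l ∈ piece k 0 1, (P.rep : MvPolynomial (Fin 4) k) = q * l}

/-- `p₀, p₁, p₂` are generic if `W(p) ∩ Y` is finite. -/
def IsGeneric {k : Type*} [Field k] (p : Fin 3 → MvPolynomial (Fin 4) k) : Prop :=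
  (planeW p ∩ segreY k).Finite

/-- `p₀, p₁, p₂` are non-generic if `W(p) ∩ Y` is infinite. -/
def IsNonGeneric {k : Type*} [Field k] (p : Fin 3 → MvPolynomial (Fin 4) k) : Prop :=
  (planeW p ∩ segreY k).Infinite

end BigradedSyzygy

/-!
Write `p i = f i * z + g i * w` with `f i`, `g i` binary quadratic forms in `x, y`, so that a syzygy
`A` of degree `(m, 1)` is a vector orthogonal to `f` and to `g`.

**The vector `f × g` is primitive.** At a common zero of its entries outside `x = y = 0`, the vectors
`f, g` are linearly dependent and a relation between them gives a common zero of the `p i`. By the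
Nullstellensatz the entries of `f × g` generate an ideal containing powers of `x` and `y`, so they
have no common factor (`isPrimitiveVec_cross_quad`). It follows that the syzygies of degree `(m, 1)`
are the multiples of `f × g` (`hilbert_one`).

**There is no syzygy of degree `(3, 2)`.** This is the vanishing of `H⁰` of the middle term and of
`H¹` of the first term of the Koszul complex, done by hand in `eq_zero_of_syzygy_three_two`: a syzygy
`a z + b w` with `g ⬝ a ≠ 0` has `a = v × f`, `b = v × g` for the vector of rational functions
`v = (a × b) / (g ⬝ a)`, which is regular because `f × g` is primitive, and has degree `-1`; if
`g ⬝ a = 0` then `a` and `b` are multiples of `f × g`, of larger degree than theirs.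
Since `R_{1,1}³` and `R_{3,2}` both have dimension `12`, the ideal of the `p i` contains `R_{3,2}` and
hence `R_{m,n}` for `m ≥ 3`, `n ≥ 2`, where rank-nullity gives the Hilbert function
(`hilbert_of_three_le`).

**The remaining case is `m = 2`.** Here the syzygies are the vectors over `k[z, w]` orthogonal to the
three columns of the `3 × 3` matrix of linear forms in `z, w` with rows the coefficients of
the `p i` at `x², xy, y²`. If its determinant `cubic F G` is nonzero there are none. If it
vanishes, a nonzero cross product of two columns is a syzygy with quadratic entries; it is primitive,
since otherwise dividing it by a linear form would give a syzygy excluded above, and all syzygies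
are multiples of it (`hilbert_two_of_cubic_eq_zero`).

**Genericity means that the cubic is nonzero.** A decomposable element `q * l` of `W(p)` shows
that the `p i` become dependent at the zero of `l`, which is therefore a zero of the cubic; each
zero arises from at most one element of `W(p)`, because otherwise the `p i` would have
a common zero (`finite_of_cubic_ne_zero`, `infinite_of_cubic_eq_zero`).
-/

namespace BigradedSyzygy

/-! ### Bigraded pieces of the polynomial ring -/

section Pieces

variable {k : Type*} [Field k]

lemma weight_bidegree (d : Fin 4 →₀ ℕ) :
    Finsupp.weight bidegree d = (((d 0 + d 1 : ℕ) : ℤ), ((d 2 + d 3 : ℕ) : ℤ)) := by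
  rw [Finsupp.weight_apply, Finsupp.sum_fintype _ _ (by simp), Fin.sum_univ_four]
  simp [bidegree]

lemma mem_piece_iff {m n : ℤ} {P : MvPolynomial (Fin 4) k} :
    P ∈ piece k m n ↔
      ∀ d, coeff d P ≠ 0 → ((d 0 + d 1 : ℕ) : ℤ) = m ∧ ((d 2 + d 3 : ℕ) : ℤ) = n := by
  rw [piece, mem_weightedHomogeneousSubmodule, IsWeightedHomogeneous]
  simp only [weight_bidegree, Prod.mk.injEq]

lemma mul_mem_piece {a b c d m n : ℤ} {P Q : MvPolynomial (Fin 4) k} (hP : P ∈ piece k a b)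
    (hQ : Q ∈ piece k c d) (hm : m = a + c) (hn : n = b + d) : P * Q ∈ piece k m n := by
  subst hm hn
  exact IsWeightedHomogeneous.mul hP hQ

lemma monomial_mem_piece {m n : ℤ} (d : Fin 4 →₀ ℕ) (r : k)
    (hm : ((d 0 + d 1 : ℕ) : ℤ) = m) (hn : ((d 2 + d 3 : ℕ) : ℤ) = n) :
    monomial d r ∈ piece k m n := by
  refine isWeightedHomogeneous_monomial _ _ _ ?_
  rw [weight_bidegree, hm, hn]

lemma X_mem_piece (i : Fin 4) :
    (X i : MvPolynomial (Fin 4) k) ∈ piece k (bidegree i).1 (bidegree i).2 :=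
  isWeightedHomogeneous_X k bidegree i

lemma X_zero_mem_piece : (X 0 : MvPolynomial (Fin 4) k) ∈ piece k 1 0 := X_mem_piece 0
lemma X_one_mem_piece : (X 1 : MvPolynomial (Fin 4) k) ∈ piece k 1 0 := X_mem_piece 1
lemma X_two_mem_piece : (X 2 : MvPolynomial (Fin 4) k) ∈ piece k 0 1 := X_mem_piece 2
lemma X_three_mem_piece : (X 3 : MvPolynomial (Fin 4) k) ∈ piece k 0 1 := X_mem_piece 3

lemma C_mul_mem_piece {m n : ℤ} (r : k) {P : MvPolynomial (Fin 4) k} (hP : P ∈ piece k m n) :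
    C r * P ∈ piece k m n := by
  rw [← smul_eq_C_mul]
  exact Submodule.smul_mem _ _ hP

lemma piece_eq_bot {m n : ℤ} (h : m < 0 ∨ n < 0) : piece k m n = ⊥ := by
  rw [eq_bot_iff]
  intro P hP
  rw [mem_piece_iff] at hP
  rw [Submodule.mem_bot]
  ext d
  by_contra hd
  have := hP d hd
  omega

/-- Induction over the monomials of bidegree `(m, n)`. -/
lemma piece_induction {m n : ℤ} {motive : ∀ P : MvPolynomial (Fin 4) k, P ∈ piece k m n → Prop}
    (zero : motive 0 (zero_mem _))
    (add : ∀ P Q hP hQ, motive P hP → motive Q hQ → motive (P + Q) (add_mem hP hQ))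
    (mono : ∀ (d : Fin 4 →₀ ℕ) (r : k) (hm : ((d 0 + d 1 : ℕ) : ℤ) = m)
      (hn : ((d 2 + d 3 : ℕ) : ℤ) = n), motive (monomial d r) (monomial_mem_piece d r hm hn))
    {P : MvPolynomial (Fin 4) k} (hP : P ∈ piece k m n) : motive P hP := by
  suffices h : ∃ hP, motive P hP from h.2
  have hP' := mem_piece_iff.mp hP
  rw [P.as_sum]
  refine Finset.sum_induction _ (fun P => ∃ hP, motive P hP)
    (fun P Q ⟨hP, h⟩ ⟨hQ, h'⟩ => ⟨_, add P Q hP hQ h h'⟩) ⟨_, zero⟩ fun d hd => ?_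
  obtain ⟨h1, h2⟩ := hP' d (mem_support_iff.mp hd)
  exact ⟨_, mono d _ h1 h2⟩

lemma monomial_eq_mul_X {d : Fin 4 →₀ ℕ} (r : k) {i : Fin 4} (hi : 0 < d i) :
    monomial d r = monomial (d - Finsupp.single i 1) r * X i := by
  rw [X, monomial_mul, mul_one, tsub_add_cancel_of_le]
  rwa [Finsupp.single_le_iff, Nat.succ_le_iff]

lemma exists_eq_mul_z_add_mul_w {m n : ℤ} (hn : 0 < n) {P : MvPolynomial (Fin 4) k}
    (hP : P ∈ piece k m n) :
    ∃ Q ∈ piece k m (n - 1), ∃ S ∈ piece k m (n - 1), P = Q * X 2 + S * X 3 := by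
  induction hP using piece_induction with
  | zero => exact ⟨0, zero_mem _, 0, zero_mem _, by simp⟩
  | add P P' _ _ h h' =>
    obtain ⟨Q, hQ, S, hS, rfl⟩ := h
    obtain ⟨Q', hQ', S', hS', rfl⟩ := h'
    exact ⟨_, add_mem hQ hQ', _, add_mem hS hS', by ring⟩
  | mono d r h1 h2 =>
    rcases Nat.eq_zero_or_pos (d 2) with h | h
    · have h3 : 0 < d 3 := by omega
      refine ⟨0, zero_mem _, _, monomial_mem_piece (d - Finsupp.single 3 1) r ?_ ?_, ?_⟩
      · simpa using h1
      · simp; omega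
      · simpa using monomial_eq_mul_X r h3
    · refine ⟨_, monomial_mem_piece (d - Finsupp.single 2 1) r ?_ ?_, 0, zero_mem _, ?_⟩
      · simpa using h1
      · simp; omega
      · simpa using monomial_eq_mul_X r h

lemma exists_eq_mul_x_add_mul_y {m n : ℤ} (hm : 0 < m) {P : MvPolynomial (Fin 4) k}
    (hP : P ∈ piece k m n) :
    ∃ Q ∈ piece k (m - 1) n, ∃ S ∈ piece k (m - 1) n, P = Q * X 0 + S * X 1 := by
  induction hP using piece_induction with
  | zero => exact ⟨0, zero_mem _, 0, zero_mem _, by simp⟩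
  | add P P' _ _ h h' =>
    obtain ⟨Q, hQ, S, hS, rfl⟩ := h
    obtain ⟨Q', hQ', S', hS', rfl⟩ := h'
    exact ⟨_, add_mem hQ hQ', _, add_mem hS hS', by ring⟩
  | mono d r h1 h2 =>
    rcases Nat.eq_zero_or_pos (d 0) with h | h
    · have h3 : 0 < d 1 := by omega
      refine ⟨0, zero_mem _, _, monomial_mem_piece (d - Finsupp.single 1 1) r ?_ ?_, ?_⟩
      · simp; omega
      · simpa using h2
      · simpa using monomial_eq_mul_X r h3
    · refine ⟨_, monomial_mem_piece (d - Finsupp.single 0 1) r ?_ ?_, 0, zero_mem _, ?_⟩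
      · simp; omega
      · simpa using h2
      · simpa using monomial_eq_mul_X r h

lemma exists_eq_C {P : MvPolynomial (Fin 4) k} (hP : P ∈ piece k 0 0) : ∃ r : k, P = C r := by
  induction hP using piece_induction with
  | zero => exact ⟨0, by simp⟩
  | add P P' _ _ h h' =>
    obtain ⟨r, rfl⟩ := h
    obtain ⟨r', rfl⟩ := h'
    exact ⟨r + r', by simp⟩
  | mono d r h1 h2 =>
    refine ⟨r, ?_⟩
    have : d = 0 := by
      ext i
      fin_cases i <;> simp <;> omega
    rw [this]
    rfl

/-- The monomials of bidegree `(m, n)` are the products of a monomial of degree `m` in `x, y`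
and one of degree `n` in `z, w`. -/
noncomputable def exponentEquiv (m n : ℕ) :
    {d : Fin 4 →₀ ℕ // Finsupp.weight bidegree d = ((m : ℤ), (n : ℤ))} ≃
      Finset.HasAntidiagonal.antidiagonal m × Finset.HasAntidiagonal.antidiagonal n where
  toFun d := (⟨(d.1 0, d.1 1), by
      have := d.2
      rw [weight_bidegree, Prod.mk.injEq] at this
      rw [Finset.HasAntidiagonal.mem_antidiagonal]
      exact_mod_cast this.1⟩, ⟨(d.1 2, d.1 3), by
      have := d.2
      rw [weight_bidegree, Prod.mk.injEq] at this
      rw [Finset.HasAntidiagonal.mem_antidiagonal]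
      exact_mod_cast this.2⟩)
  invFun e := ⟨Finsupp.equivFunOnFinite.symm ![e.1.1.1, e.1.1.2, e.2.1.1, e.2.1.2], by
      have h1 := Finset.HasAntidiagonal.mem_antidiagonal.mp e.1.2
      have h2 := Finset.HasAntidiagonal.mem_antidiagonal.mp e.2.2
      rw [weight_bidegree]
      simp [← h1, ← h2]⟩
  left_inv d := by
    ext i
    fin_cases i <;> simp
  right_inv e := by
    ext <;> simp

lemma piece_eq_restrictSupport (m n : ℤ) :
    piece k m n = restrictSupport k {d | Finsupp.weight bidegree d = (m, n)} :=
  weightedHomogeneousSubmodule_eq_finsupp_supported _ _ _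

instance finite_piece (m n : ℤ) : Module.Finite k (piece k m n) := by
  by_cases h : m < 0 ∨ n < 0
  · rw [piece_eq_bot h]
    infer_instance
  · push Not at h
    lift m to ℕ using h.1
    lift n to ℕ using h.2
    rw [piece_eq_restrictSupport]
    have : Finite {d : Fin 4 →₀ ℕ | Finsupp.weight bidegree d = ((m : ℤ), (n : ℤ))} :=
      Finite.of_equiv _ (exponentEquiv m n).symm
    exact Module.Finite.of_basis (basisRestrictSupport k _)

lemma finrank_piece {m n : ℤ} (hm : 0 ≤ m) (hn : 0 ≤ n) :
    (Module.finrank k (piece k m n) : ℤ) = (m + 1) * (n + 1) := by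
  lift m to ℕ using hm
  lift n to ℕ using hn
  rw [piece_eq_restrictSupport, Module.finrank_eq_nat_card_basis (basisRestrictSupport k _)]
  have := Nat.card_congr (exponentEquiv m n)
  rw [Nat.card_prod, Nat.card_eq_finsetCard, Nat.card_eq_finsetCard,
    Finset.Nat.card_antidiagonal, Finset.Nat.card_antidiagonal] at this
  exact_mod_cast this

/-- A quotient of bihomogeneous polynomials is bihomogeneous. -/
lemma mem_piece_of_mul_mem {a b m n : ℤ} {P Q : MvPolynomial (Fin 4) k} (hP : P ∈ piece k a b)
    (hP0 : P ≠ 0) (h : P * Q ∈ piece k m n) : Q ∈ piece k (m - a) (n - b) := by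
  let : GradedAlgebra (weightedHomogeneousSubmodule k bidegree) :=
    weightedGradedAlgebra k bidegree
  have h1 := DirectSum.coe_decompose_mul_add_of_left_mem (weightedHomogeneousSubmodule k bidegree)
    (i := (a, b)) (j := (m - a, n - b)) (b := Q) hP
  have h2 : ((a, b) : ℤ × ℤ) + (m - a, n - b) = (m, n) := by ext <;> simp
  rw [h2, DirectSum.decompose_of_mem_same (weightedHomogeneousSubmodule k bidegree) h] at h1
  rw [mul_left_cancel₀ hP0 h1]
  exact SetLike.coe_mem _

/-- Powers of two distinct variables are coprime. -/
lemma dvd_of_dvd_X_pow_mul {i j : Fin 4} (hij : i ≠ j) {r s : ℕ} {c t : MvPolynomial (Fin 4) k}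
    (hi : c ∣ X i ^ r * t) (hj : c ∣ X j ^ s * t) : c ∣ t := by
  have hXi : (X i ^ r : MvPolynomial (Fin 4) k) ≠ 0 := pow_ne_zero _ (X_ne_zero i)
  rcases eq_or_ne c 0 with rfl | hc
  · rw [zero_dvd_iff, mul_eq_zero] at hi
    rw [hi.resolve_left hXi]
  · obtain ⟨d, hd⟩ := hi
    obtain ⟨e, he⟩ := hj
    have h1 : X j ^ s * d = X i ^ r * e := by
      apply mul_left_cancel₀ hc
      linear_combination (X i ^ r) * he - (X j ^ s) * hd
    have h2 : ¬ (X i : MvPolynomial (Fin 4) k) ∣ X j ^ s := fun h => by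
      have := (X_prime (R := k) (i := i)).dvd_of_dvd_pow h
      rw [X_dvd_X] at this
      exact hij this
    obtain ⟨d', rfl⟩ := (X_prime (R := k) (i := i)).pow_dvd_of_dvd_mul_left r h2 ⟨e, h1⟩
    exact ⟨d', mul_left_cancel₀ hXi (by linear_combination hd)⟩

lemma aeval_eq_self_of_mem_piece_zero_right {m : ℤ} {P : MvPolynomial (Fin 4) k}
    (hP : P ∈ piece k m 0)
    (r s : k) : aeval ![X 0, X 1, C r, C s] P = P := by
  induction hP using piece_induction with
  | zero => simp
  | add P Q _ _ h h' => rw [map_add, h, h']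
  | mono d r h1 h2 =>
    have h2' : d 2 = 0 := by omega
    have h3' : d 3 = 0 := by omega
    rw [aeval_monomial, monomial_eq, Finsupp.prod_fintype _ _ (by simp),
      Finsupp.prod_fintype _ _ (by simp), Fin.prod_univ_four, Fin.prod_univ_four]
    simp [h2', h3', algebraMap_eq]

lemma aeval_eq_self_of_mem_piece_zero_left {n : ℤ} {P : MvPolynomial (Fin 4) k}
    (hP : P ∈ piece k 0 n)
    (r s : k) : aeval ![C r, C s, X 2, X 3] P = P := by
  induction hP using piece_induction with
  | zero => simp
  | add P Q _ _ h h' => rw [map_add, h, h']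
  | mono d r h1 h2 =>
    have h2' : d 0 = 0 := by omega
    have h3' : d 1 = 0 := by omega
    rw [aeval_monomial, monomial_eq, Finsupp.prod_fintype _ _ (by simp),
      Finsupp.prod_fintype _ _ (by simp), Fin.prod_univ_four, Fin.prod_univ_four]
    simp [h2', h3', algebraMap_eq]

lemma eq_zero_of_quadratic_zw {m : ℤ} {P Q S : MvPolynomial (Fin 4) k} (hP : P ∈ piece k m 0)
    (hQ : Q ∈ piece k m 0) (hS : S ∈ piece k m 0)
    (h : P * X 2 ^ 2 + Q * (X 2 * X 3) + S * X 3 ^ 2 = 0) : P = 0 ∧ Q = 0 ∧ S = 0 := by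
  have e (r s : k) : P * C r ^ 2 + Q * (C r * C s) + S * C s ^ 2 = 0 := by
    have := congrArg (aeval (![X 0, X 1, C r, C s] : Fin 4 → MvPolynomial (Fin 4) k)) h
    simp only [map_add, map_mul, map_pow, map_zero, aeval_eq_self_of_mem_piece_zero_right hP,
      aeval_eq_self_of_mem_piece_zero_right hQ, aeval_eq_self_of_mem_piece_zero_right hS,
      aeval_X] at this
    exact this
  have h1 : P = 0 := by simpa using e 1 0
  have h2 : S = 0 := by simpa using e 0 1
  exact ⟨h1, by simpa [h1, h2] using e 1 1, h2⟩

lemma eq_zero_of_linear_zw {m : ℤ} {P Q : MvPolynomial (Fin 4) k} (hP : P ∈ piece k m 0)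
    (hQ : Q ∈ piece k m 0) (h : P * X 2 + Q * X 3 = 0) : P = 0 ∧ Q = 0 := by
  obtain ⟨h1, h2, -⟩ := eq_zero_of_quadratic_zw hP hQ (zero_mem _)
    (by linear_combination (X 2) * h)
  exact ⟨h1, h2⟩

lemma eq_zero_of_quadratic_xy {n : ℤ} {P Q S : MvPolynomial (Fin 4) k} (hP : P ∈ piece k 0 n)
    (hQ : Q ∈ piece k 0 n) (hS : S ∈ piece k 0 n)
    (h : P * X 0 ^ 2 + Q * (X 0 * X 1) + S * X 1 ^ 2 = 0) : P = 0 ∧ Q = 0 ∧ S = 0 := by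
  have e (r s : k) : P * C r ^ 2 + Q * (C r * C s) + S * C s ^ 2 = 0 := by
    have := congrArg (aeval (![C r, C s, X 2, X 3] : Fin 4 → MvPolynomial (Fin 4) k)) h
    simp only [map_add, map_mul, map_pow, map_zero, aeval_eq_self_of_mem_piece_zero_left hP,
      aeval_eq_self_of_mem_piece_zero_left hQ, aeval_eq_self_of_mem_piece_zero_left hS,
      aeval_X] at this
    exact this
  have h1 : P = 0 := by simpa using e 1 0
  have h2 : S = 0 := by simpa using e 0 1
  exact ⟨h1, by simpa [h1, h2] using e 1 1, h2⟩

end Pieces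

open Matrix

/-! ### Primitive vectors -/

section Primitive

variable {k : Type*} [Field k]

/-- A vector of polynomials whose entries have no common factor, phrased as the cancellation
property which a greatest common divisor equal to `1` gives. -/
def IsPrimitiveVec (Q : Fin 3 → MvPolynomial (Fin 4) k) : Prop :=
  ∀ c t : MvPolynomial (Fin 4) k, (∀ i, c ∣ Q i * t) → c ∣ t

lemma IsPrimitiveVec.exists_ne_zero {Q : Fin 3 → MvPolynomial (Fin 4) k} (hQ : IsPrimitiveVec Q) :
    ∃ j, Q j ≠ 0 := by
  by_contra! h
  exact one_ne_zero (zero_dvd_iff.mp (hQ 0 1 fun i => by simp [h i]))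

/-- By the Nullstellensatz, a vector whose common zeros lie on a coordinate subspace of
codimension two is primitive. -/
lemma isPrimitiveVec_of_zeros [IsAlgClosed k] {Q : Fin 3 → MvPolynomial (Fin 4) k} {a b : Fin 4}
    (hab : a ≠ b)
    (h : ∀ pt : Fin 4 → k, (∀ i, eval pt (Q i) = 0) → pt a = 0 ∧ pt b = 0) :
    IsPrimitiveVec Q := by
  intro c t hc
  have key : ∀ q ∈ Ideal.span (Set.range Q), c ∣ q * t := by
    intro q hq
    induction hq using Submodule.span_induction with
    | mem x hx =>
      obtain ⟨i, rfl⟩ := hx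
      exact hc i
    | zero => simp
    | add x y _ _ hx hy =>
      rw [add_mul]
      exact dvd_add hx hy
    | smul r x _ hx =>
      rw [smul_eq_mul, mul_assoc]
      exact hx.mul_left r
  have rad : ∀ i : Fin 4, (∀ pt : Fin 4 → k, (∀ i, eval pt (Q i) = 0) → pt i = 0) →
      ∃ s : ℕ, (X i : MvPolynomial (Fin 4) k) ^ s ∈ Ideal.span (Set.range Q) := by
    intro i hi
    rw [← Ideal.mem_radical_iff, ← vanishingIdeal_zeroLocus_eq_radical (K := k)]
    intro pt hpt
    rw [aeval_X]
    refine hi pt fun j => ?_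
    simpa using hpt (Q j) (Ideal.subset_span ⟨j, rfl⟩)
  obtain ⟨r, hr⟩ := rad a fun pt hpt => (h pt hpt).1
  obtain ⟨s, hs⟩ := rad b fun pt hpt => (h pt hpt).2
  exact dvd_of_dvd_X_pow_mul hab (key _ hr) (key _ hs)

/-- A vector parallel to a primitive vector is a multiple of it. -/
lemma IsPrimitiveVec.exists_eq_smul {Q A : Fin 3 → MvPolynomial (Fin 4) k}
    (hQ : IsPrimitiveVec Q) (hA : ∀ i j, A i * Q j = A j * Q i) :
    ∃ h : MvPolynomial (Fin 4) k, A = h • Q := by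
  obtain ⟨j, hj⟩ := hQ.exists_ne_zero
  obtain ⟨h, hh⟩ := hQ (Q j) (A j) fun i => ⟨A i, by linear_combination -(hA i j)⟩
  refine ⟨h, funext fun i => mul_left_cancel₀ hj ?_⟩
  rw [Pi.smul_apply, smul_eq_mul]
  linear_combination hA i j + Q i * hh

lemma IsPrimitiveVec.mem_piece_of_smul {Q : Fin 3 → MvPolynomial (Fin 4) k}
    (hQ : IsPrimitiveVec Q) {a b m n : ℤ} (hQm : ∀ i, Q i ∈ piece k a b)
    {h : MvPolynomial (Fin 4) k} (hA : ∀ i, (h • Q) i ∈ piece k m n) :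
    h ∈ piece k (m - a) (n - b) := by
  obtain ⟨j, hj⟩ := hQ.exists_ne_zero
  refine mem_piece_of_mul_mem (hQm j) hj ?_
  simpa [mul_comm] using hA j

lemma mul_eq_mul_of_cross_eq_zero {R : Type*} [CommRing R] {A Q : Fin 3 → R} (h : A ⨯₃ Q = 0)
    (i j : Fin 3) : A i * Q j = A j * Q i := by
  have h0 := congrFun h 0
  have h1 := congrFun h 1
  have h2 := congrFun h 2
  simp only [cross_apply, Pi.zero_apply, Matrix.cons_val] at h0 h1 h2
  fin_cases i <;> fin_cases j <;> dsimp <;> grind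

/-- A vector orthogonal to two vectors is parallel to their cross product. -/
lemma cross_cross_eq_zero {R : Type*} [CommRing R] {A f g : Fin 3 → R} (hf : A ⬝ᵥ f = 0)
    (hg : A ⬝ᵥ g = 0) : A ⨯₃ (f ⨯₃ g) = 0 := by
  rw [cross_cross_eq_smul_sub_smul', hg, dotProduct_comm, hf]
  simp

lemma dotProduct_mem_piece {a b m n u v : ℤ} {A B : Fin 3 → MvPolynomial (Fin 4) k}
    (hA : ∀ i, A i ∈ piece k a b) (hB : ∀ i, B i ∈ piece k m n) (hu : u = a + m)
    (hv : v = b + n) : A ⬝ᵥ B ∈ piece k u v :=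
  Submodule.sum_mem _ fun i _ => mul_mem_piece (hA i) (hB i) hu hv

lemma cross_mem_piece {a b m n u v : ℤ} {A B : Fin 3 → MvPolynomial (Fin 4) k}
    (hA : ∀ i, A i ∈ piece k a b) (hB : ∀ i, B i ∈ piece k m n) (hu : u = a + m)
    (hv : v = b + n) (i : Fin 3) : (A ⨯₃ B) i ∈ piece k u v := by
  have h (i j : Fin 3) : A i * B j ∈ piece k u v := mul_mem_piece (hA i) (hB j) hu hv
  rw [cross_apply]
  fin_cases i <;> exact sub_mem (h _ _) (h _ _)

/-- If `A` is orthogonal to a pair `f, g` of primitive cross product, it is a multiple of it, by a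
form whose bidegree is dictated by that of `A`. -/
lemma exists_eq_smul_cross {A f g : Fin 3 → MvPolynomial (Fin 4) k}
    (hprim : IsPrimitiveVec (f ⨯₃ g)) (hAf : A ⬝ᵥ f = 0) (hAg : A ⬝ᵥ g = 0) {a b m n : ℤ}
    (hN : ∀ i, (f ⨯₃ g) i ∈ piece k a b) (hA : ∀ i, A i ∈ piece k m n) :
    ∃ h ∈ piece k (m - a) (n - b), A = h • (f ⨯₃ g) := by
  obtain ⟨h, rfl⟩ := IsPrimitiveVec.exists_eq_smul hprim
    (mul_eq_mul_of_cross_eq_zero (cross_cross_eq_zero hAf hAg))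
  exact ⟨h, IsPrimitiveVec.mem_piece_of_smul hprim hN hA, rfl⟩

end Primitive

/-! ### There are no syzygies of bidegree `(3, 2)` -/

section NoSyzygy

/-- If `(a z + b w) ⬝ (f z + g w) = 0` and `c = g ⬝ a`, then the pair `a, b` is the Koszul
pair `v × f, v × g` with `v = (a × b) / c` wherever `c` does not vanish. The divisibility
says that `v` has no poles where `f × g` does not vanish. -/
lemma dvd_cross_mul_cross {R : Type*} [CommRing R] {f g a b : Fin 3 → R} (h1 : f ⬝ᵥ a = 0)
    (h2 : g ⬝ᵥ b = 0) (h3 : g ⬝ᵥ a + f ⬝ᵥ b = 0) (i j : Fin 3) :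
    g ⬝ᵥ a ∣ (f ⨯₃ g) i * (a ⨯₃ b) j := by
  have key : (f ⨯₃ g) i * (a ⨯₃ b) j =
      (if i = j then (f ⬝ᵥ a) * (g ⬝ᵥ b) - (f ⬝ᵥ b) * (g ⬝ᵥ a) else 0) +
      a i * ((f ⬝ᵥ b) * g j - (g ⬝ᵥ b) * f j) - b i * ((f ⬝ᵥ a) * g j - (g ⬝ᵥ a) * f j) := by
    simp only [cross_apply, dotProduct, Fin.sum_univ_three]
    fin_cases i <;> fin_cases j <;> simp <;> ring
  refine ⟨(if i = j then g ⬝ᵥ a else 0) - a i * g j + b i * f j, ?_⟩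
  rw [key, h1, h2, eq_neg_of_add_eq_zero_right h3]
  split_ifs <;> ring

variable {k : Type*} [Field k] {f g : Fin 3 → MvPolynomial (Fin 4) k}

/-- A vector orthogonal to `f` and `g` is a multiple of `f × g`, whose entries have degree `4`. -/
lemma eq_zero_of_orthogonal (hf : ∀ i, f i ∈ piece k 2 0) (hg : ∀ i, g i ∈ piece k 2 0)
    (hprim : IsPrimitiveVec (f ⨯₃ g)) {A : Fin 3 → MvPolynomial (Fin 4) k} {m : ℤ} (hm : m < 4)
    (hA : ∀ i, A i ∈ piece k m 0) (hAf : A ⬝ᵥ f = 0) (hAg : A ⬝ᵥ g = 0) : A = 0 := by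
  obtain ⟨h, hh, rfl⟩ := exists_eq_smul_cross hprim hAf hAg
    (cross_mem_piece hf hg (u := 4) (v := 0) (by norm_num) (by norm_num)) hA
  rw [piece_eq_bot (by omega), Submodule.mem_bot] at hh
  rw [hh, zero_smul]

/-- There is no nonzero syzygy `A = a z + b w` with `a, b` linear in `x, y`: if `g ⬝ a ≠ 0`, the
vector `v` with `a, b = v × f, v × g` would have entries of degree `-1`, and if `g ⬝ a = 0`, then
`a` and `b` are multiples of `f × g`, whose entries have degree `4`. -/
lemma eq_zero_of_syzygy_three_two (hf : ∀ i, f i ∈ piece k 2 0) (hg : ∀ i, g i ∈ piece k 2 0)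
    (hprim : IsPrimitiveVec (f ⨯₃ g)) {A : Fin 3 → MvPolynomial (Fin 4) k}
    (hA : ∀ i, A i ∈ piece k 1 1)
    (h : A ⬝ᵥ (fun i => f i * X 2 + g i * X 3) = 0) : A = 0 := by
  have hdec (i : Fin 3) := exists_eq_mul_z_add_mul_w (by norm_num) (hA i)
  simp only [sub_self] at hdec
  choose a ha b hb hab using hdec
  have h' : (a ⬝ᵥ f) * X 2 ^ 2 + (g ⬝ᵥ a + f ⬝ᵥ b) * (X 2 * X 3) + (b ⬝ᵥ g) * X 3 ^ 2 = 0 := by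
    rw [← h]
    simp only [dotProduct, Fin.sum_univ_three, hab]
    ring
  obtain ⟨h1, h2, h3⟩ := eq_zero_of_quadratic_zw (m := 3)
    (dotProduct_mem_piece ha hf (by norm_num) (by norm_num))
    (add_mem (dotProduct_mem_piece hg ha (by norm_num) (by norm_num))
      (dotProduct_mem_piece hf hb (by norm_num) (by norm_num)))
    (dotProduct_mem_piece hb hg (by norm_num) (by norm_num)) h'
  have hcm : g ⬝ᵥ a ∈ piece k 3 0 := dotProduct_mem_piece hg ha (by norm_num) (by norm_num)
  -- The entries of `a ⨯₃ b`, of degree `2`, are multiples of `g ⬝ᵥ a`, of degree `3`.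
  have hc : g ⬝ᵥ a = 0 := by
    by_contra hc
    have hzero : a ⨯₃ b = 0 := by
      funext j
      obtain ⟨d, hd⟩ := hprim (g ⬝ᵥ a) ((a ⨯₃ b) j) fun i =>
        dvd_cross_mul_cross (by rwa [dotProduct_comm]) (by rwa [dotProduct_comm]) h2 i j
      have hm := cross_mem_piece ha hb (u := 2) (v := 0) (by norm_num) (by norm_num) j
      rw [hd] at hm
      have hd0 := mem_piece_of_mul_mem hcm hc hm
      rw [piece_eq_bot (by norm_num), Submodule.mem_bot] at hd0
      rw [hd, hd0, mul_zero, Pi.zero_apply]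
    have hsq := cross_dot_cross f g a b
    rw [hzero, dotProduct_zero, dotProduct_comm g b, h3, eq_neg_of_add_eq_zero_right h2] at hsq
    have : (g ⬝ᵥ a) ^ 2 = 0 := by linear_combination -hsq
    exact hc (pow_eq_zero_iff two_ne_zero |>.mp this)
  have ha0 := eq_zero_of_orthogonal hf hg hprim (by norm_num) ha h1
    (by rwa [dotProduct_comm])
  have hb0 := eq_zero_of_orthogonal hf hg hprim (by norm_num) hb
    (by rw [dotProduct_comm]; simpa [hc] using h2) h3
  funext i
  rw [hab, ha0, hb0]
  simp

end NoSyzygy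

/-! ### Coefficients of the forms of bidegree `(2, 1)` -/

section Coefficients

variable {k : Type*} [Field k]

/-- The binary quadratic form in `x, y` with given coefficients. -/
noncomputable def quad (F : Fin 3 → k) : MvPolynomial (Fin 4) k :=
  C (F 0) * X 0 ^ 2 + C (F 1) * (X 0 * X 1) + C (F 2) * X 1 ^ 2

lemma quad_mem_piece (F : Fin 3 → k) : quad F ∈ piece k 2 0 := by
  have h0 : (X 0 : MvPolynomial (Fin 4) k) ∈ piece k 1 0 := X_zero_mem_piece
  have h1 : (X 1 : MvPolynomial (Fin 4) k) ∈ piece k 1 0 := X_one_mem_piece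
  rw [quad, pow_two, pow_two]
  exact add_mem (add_mem (C_mul_mem_piece _ (mul_mem_piece h0 h0 (by norm_num) (by norm_num)))
    (C_mul_mem_piece _ (mul_mem_piece h0 h1 (by norm_num) (by norm_num))))
    (C_mul_mem_piece _ (mul_mem_piece h1 h1 (by norm_num) (by norm_num)))

lemma exists_eq_quad {P : MvPolynomial (Fin 4) k} (hP : P ∈ piece k 2 0) :
    ∃ F : Fin 3 → k, P = quad F := by
  obtain ⟨Q, hQ, S, hS, rfl⟩ := exists_eq_mul_x_add_mul_y (by norm_num) hP
  obtain ⟨q, hq, q', hq', rfl⟩ := exists_eq_mul_x_add_mul_y (by norm_num) hQ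
  obtain ⟨s, hs, s', hs', rfl⟩ := exists_eq_mul_x_add_mul_y (by norm_num) hS
  norm_num at hq hq' hs hs'
  obtain ⟨a, rfl⟩ := exists_eq_C hq
  obtain ⟨b, rfl⟩ := exists_eq_C hq'
  obtain ⟨c, rfl⟩ := exists_eq_C hs
  obtain ⟨d, rfl⟩ := exists_eq_C hs'
  refine ⟨![a, b + c, d], ?_⟩
  simp [quad]
  ring

lemma eval_quad (F : Fin 3 → k) (pt : Fin 4 → k) :
    eval pt (quad F) = F 0 * pt 0 ^ 2 + F 1 * (pt 0 * pt 1) + F 2 * pt 1 ^ 2 := by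
  simp [quad]

lemma quad_eq_zero_iff {F : Fin 3 → k} : quad F = 0 ↔ F = 0 := by
  constructor
  · intro h
    have e (a b : k) : F 0 * a ^ 2 + F 1 * (a * b) + F 2 * b ^ 2 = 0 := by
      simpa [eval_quad] using congrArg (eval ![a, b, 0, 0]) h
    have h0 : F 0 = 0 := by simpa using e 1 0
    have h2 : F 2 = 0 := by simpa using e 0 1
    have h1 : F 1 = 0 := by simpa [h0, h2] using e 1 1
    funext i
    fin_cases i
    exacts [h0, h1, h2]
  · rintro rfl
    simp [quad]

/-- The form of bidegree `(2, 1)` with given coefficients at `z` and `w`. -/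
noncomputable def form (F G : Fin 3 → k) : MvPolynomial (Fin 4) k :=
  quad F * X 2 + quad G * X 3

lemma exists_eq_form {P : MvPolynomial (Fin 4) k} (hP : P ∈ piece k 2 1) :
    ∃ F G : Fin 3 → k, P = form F G := by
  obtain ⟨Q, hQ, S, hS, rfl⟩ := exists_eq_mul_z_add_mul_w (by norm_num) hP
  obtain ⟨F, rfl⟩ := exists_eq_quad hQ
  obtain ⟨G, rfl⟩ := exists_eq_quad hS
  exact ⟨F, G, rfl⟩

lemma form_mem_piece (F G : Fin 3 → k) : form F G ∈ piece k 2 1 :=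
  add_mem (mul_mem_piece (quad_mem_piece F) X_two_mem_piece (by norm_num) (by norm_num))
    (mul_mem_piece (quad_mem_piece G) X_three_mem_piece (by norm_num) (by norm_num))

lemma eval_form (F G : Fin 3 → k) (pt : Fin 4 → k) :
    eval pt (form F G) = (F 0 * pt 0 ^ 2 + F 1 * (pt 0 * pt 1) + F 2 * pt 1 ^ 2) * pt 2 +
      (G 0 * pt 0 ^ 2 + G 1 * (pt 0 * pt 1) + G 2 * pt 1 ^ 2) * pt 3 := by
  simp [form, eval_quad]

/-- At a common zero `(x : y)` of the entries of `f × g` the vectors `f, g` are dependent, and the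
coefficients of a relation are the coordinates `(z : w)` of a common zero of the `f z + g w`. -/
lemma isPrimitiveVec_cross_quad [IsAlgClosed k] {F G : Fin 3 → Fin 3 → k}
    (hzero : NoCommonZeros fun i => form (F i) (G i)) :
    IsPrimitiveVec ((fun i => quad (F i)) ⨯₃ fun i => quad (G i)) := by
  refine isPrimitiveVec_of_zeros (a := 0) (b := 1) (by decide) fun pt hpt => ?_
  by_contra hne
  have hcross : (fun i => eval pt (quad (F i))) ⨯₃ (fun i => eval pt (quad (G i))) = 0 := by
    funext i
    have := hpt i
    simp only [cross_apply] at this ⊢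
    fin_cases i <;> simpa using this
  have hdep := mt crossProduct_ne_zero_iff_linearIndependent.mpr (not_not_intro hcross)
  rw [LinearIndependent.pair_iff] at hdep
  push Not at hdep
  obtain ⟨r, s, hrs, hrs'⟩ := hdep
  obtain ⟨i, hi⟩ := hzero ![pt 0, pt 1] ![r, s]
    (fun h => hne ⟨by simpa using congrFun h 0, by simpa using congrFun h 1⟩)
    (fun h => hrs' (by simpa using congrFun h 0) (by simpa using congrFun h 1))
  apply hi
  have := congrFun hrs i
  simp only [Pi.add_apply, Pi.smul_apply, smul_eq_mul, eval_quad, Pi.zero_apply] at this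
  simp only [eval_form, Matrix.cons_val]
  linear_combination this

end Coefficients

/-! ### Hilbert functions of the pieces of the syzygy module -/

section Hilbert

variable {k : Type*} [Field k] {p : Fin 3 → MvPolynomial (Fin 4) k}

lemma mem_syzPiece {m n : ℤ} {A : Fin 3 → MvPolynomial (Fin 4) k} :
    A ∈ syzPiece p m n ↔ A ⬝ᵥ p = 0 ∧ ∀ i, A i ∈ piece k (m - 2) (n - 1) := by
  simp [syzPiece, syz, Fintype.linearCombination_apply, Submodule.mem_pi, dotProduct]

/-- The triples of forms of bidegree `(m, n)`. -/
noncomputable def triples (k : Type*) [Field k] (m n : ℤ) :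
    Submodule k (Fin 3 → MvPolynomial (Fin 4) k) :=
  Submodule.pi Set.univ fun _ => piece k m n

lemma mem_triples {m n : ℤ} {A : Fin 3 → MvPolynomial (Fin 4) k} :
    A ∈ triples k m n ↔ ∀ i, A i ∈ piece k m n := by
  simp [triples, Submodule.mem_pi]

lemma triples_eq_range (m n : ℤ) :
    triples k m n = LinearMap.range ((piece k m n).subtype.compLeft (Fin 3)) := by
  ext A
  rw [mem_triples, LinearMap.mem_range]
  constructor
  · intro h
    exact ⟨fun i => ⟨A i, h i⟩, rfl⟩
  · rintro ⟨B, rfl⟩ i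
    exact (B i).2

instance finite_triples (m n : ℤ) : Module.Finite k (triples k m n) := by
  rw [triples_eq_range]
  infer_instance

lemma finrank_triples (m n : ℤ) :
    Module.finrank k (triples k m n) = 3 * Module.finrank k (piece k m n) := by
  rw [triples_eq_range, LinearMap.finrank_range_of_inj, Module.finrank_pi_fintype]
  · simp
  · intro A B h
    funext i
    exact Subtype.ext (congrFun h i)

lemma finite_syzPiece (m n : ℤ) : Module.Finite k (syzPiece p m n) :=
  Submodule.finiteDimensional_of_le (S₂ := triples k (m - 2) (n - 1)) inf_le_right

lemma syzPiece_eq_bot_of_neg {m n : ℤ} (h : m < 2 ∨ n < 1) : syzPiece p m n = ⊥ := by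
  rw [eq_bot_iff]
  intro A hA
  rw [mem_syzPiece, piece_eq_bot (by omega)] at hA
  rw [Submodule.mem_bot]
  funext i
  exact hA.2 i

lemma hilbert_eq_zero {m n : ℤ} (h : syzPiece p m n = ⊥) : hilbert (syzPiece p) m n = 0 := by
  rw [hilbert, h, finrank_bot]

/-- The degree `(m, n)` piece of the ideal `(p₀, p₁, p₂)`. -/
noncomputable def idealPiece (p : Fin 3 → MvPolynomial (Fin 4) k) (m n : ℤ) :
    Submodule k (MvPolynomial (Fin 4) k) :=
  (triples k (m - 2) (n - 1)).map
    ((Fintype.linearCombination (MvPolynomial (Fin 4) k) p).restrictScalars k)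

lemma mem_idealPiece {m n : ℤ} {P : MvPolynomial (Fin 4) k} :
    P ∈ idealPiece p m n ↔
      ∃ A : Fin 3 → MvPolynomial (Fin 4) k,
        (∀ i, A i ∈ piece k (m - 2) (n - 1)) ∧ A ⬝ᵥ p = P := by
  simp [idealPiece, mem_triples, Fintype.linearCombination_apply, dotProduct]

lemma hilbert_add_finrank_idealPiece (m n : ℤ) :
    hilbert (syzPiece p) m n + Module.finrank k (idealPiece p m n) =
      3 * Module.finrank k (piece k (m - 2) (n - 1)) := by
  set L := (Fintype.linearCombination (MvPolynomial (Fin 4) k) p).restrictScalars k with hL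
  have h := LinearMap.finrank_range_add_finrank_ker (L.domRestrict (triples k (m - 2) (n - 1)))
  rw [LinearMap.range_domRestrict, finrank_triples] at h
  have hker : (LinearMap.ker (L.domRestrict (triples k (m - 2) (n - 1)))).map
      (triples k (m - 2) (n - 1)).subtype = syzPiece p m n := by
    rw [LinearMap.ker_domRestrict, Submodule.map_comap_subtype, inf_comm]
    rfl
  rw [← h, ← Submodule.finrank_map_subtype_eq, hker, add_comm]
  rfl

lemma idealPiece_le (hp : ∀ i, p i ∈ piece k 2 1) (m n : ℤ) :
    idealPiece p m n ≤ piece k m n := by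
  intro P hP
  obtain ⟨A, hA, rfl⟩ := mem_idealPiece.mp hP
  exact dotProduct_mem_piece hA hp (by ring) (by ring)

/-- Both `R_{1,1}³` and `R_{3,2}` have dimension `12`. -/
lemma idealPiece_eq_three_two (hp : ∀ i, p i ∈ piece k 2 1) (h : syzPiece p 3 2 = ⊥) :
    idealPiece p 3 2 = piece k 3 2 := by
  refine Submodule.eq_of_le_of_finrank_eq (idealPiece_le hp 3 2) ?_
  have h1 := hilbert_add_finrank_idealPiece (p := p) 3 2
  rw [hilbert_eq_zero h] at h1
  have h2 := finrank_piece (k := k) (m := 3) (n := 2) (by norm_num) (by norm_num)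
  have h3 := finrank_piece (k := k) (m := 3 - 2) (n := 2 - 1) (by norm_num) (by norm_num)
  norm_num at h2 h3
  norm_num at h1
  omega

lemma idealPiece_succ_right {m n : ℤ} (hn : 0 ≤ n) (h : idealPiece p m n = piece k m n)
    (hp : ∀ i, p i ∈ piece k 2 1) : idealPiece p m (n + 1) = piece k m (n + 1) := by
  refine le_antisymm (idealPiece_le hp _ _) fun P hP => ?_
  obtain ⟨Q, hQ, S, hS, rfl⟩ := exists_eq_mul_z_add_mul_w (by omega) hP
  rw [add_sub_cancel_right, ← h] at hQ hS
  obtain ⟨A, hA, rfl⟩ := mem_idealPiece.mp hQ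
  obtain ⟨B, hB, rfl⟩ := mem_idealPiece.mp hS
  refine mem_idealPiece.mpr ⟨fun i => A i * X 2 + B i * X 3, fun i => add_mem
    (mul_mem_piece (hA i) X_two_mem_piece (by ring) (by ring))
    (mul_mem_piece (hB i) X_three_mem_piece (by ring) (by ring)), ?_⟩
  simp only [dotProduct, Fin.sum_univ_three]
  ring

lemma idealPiece_succ_left {m n : ℤ} (hm : 0 ≤ m) (h : idealPiece p m n = piece k m n)
    (hp : ∀ i, p i ∈ piece k 2 1) : idealPiece p (m + 1) n = piece k (m + 1) n := by
  refine le_antisymm (idealPiece_le hp _ _) fun P hP => ?_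
  obtain ⟨Q, hQ, S, hS, rfl⟩ := exists_eq_mul_x_add_mul_y (by omega) hP
  rw [add_sub_cancel_right, ← h] at hQ hS
  obtain ⟨A, hA, rfl⟩ := mem_idealPiece.mp hQ
  obtain ⟨B, hB, rfl⟩ := mem_idealPiece.mp hS
  refine mem_idealPiece.mpr ⟨fun i => A i * X 0 + B i * X 1, fun i => add_mem
    (mul_mem_piece (hA i) X_zero_mem_piece (by ring) (by ring))
    (mul_mem_piece (hB i) X_one_mem_piece (by ring) (by ring)), ?_⟩
  simp only [dotProduct, Fin.sum_univ_three]
  ring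

lemma idealPiece_eq (hp : ∀ i, p i ∈ piece k 2 1) (h : syzPiece p 3 2 = ⊥) {m n : ℤ}
    (hm : 3 ≤ m) (hn : 2 ≤ n) : idealPiece p m n = piece k m n := by
  have hrow : idealPiece p m 2 = piece k m 2 := by
    induction m, hm using Int.leInduction with
    | base => exact idealPiece_eq_three_two hp h
    | succ m hm ih => exact idealPiece_succ_left (by omega) ih hp
  induction n, hn using Int.leInduction with
  | base => exact hrow
  | succ n hn ih => exact idealPiece_succ_right (by omega) ih hp

/-- Where `p₀, p₁, p₂` generate everything, rank-nullity gives the Hilbert function. -/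
lemma hilbert_of_three_le (hp : ∀ i, p i ∈ piece k 2 1) (h : syzPiece p 3 2 = ⊥) {m n : ℤ}
    (hm : 3 ≤ m) (hn : 2 ≤ n) :
    (hilbert (syzPiece p) m n : ℤ) = 3 * ((m - 1) * n) - (m + 1) * (n + 1) := by
  have h1 := hilbert_add_finrank_idealPiece (p := p) m n
  rw [idealPiece_eq hp h hm hn] at h1
  have h2 := finrank_piece (k := k) (m := m) (n := n) (by omega) (by omega)
  have h3 := finrank_piece (k := k) (m := m - 2) (n := n - 1) (by omega) (by omega)
  zify at h1
  rw [h2, h3] at h1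
  linear_combination h1

/-- The Hilbert function of a piece whose elements are the multiples of a fixed syzygy. -/
lemma hilbert_of_multiples {Q : Fin 3 → MvPolynomial (Fin 4) k} (hQ0 : Q ≠ 0) (hQp : Q ⬝ᵥ p = 0)
    {a b m n : ℤ} (hQ : ∀ i, Q i ∈ piece k a b)
    (h : ∀ A ∈ syzPiece p m n, ∃ c ∈ piece k (m - 2 - a) (n - 1 - b), A = c • Q) :
    hilbert (syzPiece p) m n = Module.finrank k (piece k (m - 2 - a) (n - 1 - b)) := by
  set φ := (LinearMap.toSpanSingleton (MvPolynomial (Fin 4) k) _ Q).restrictScalars k with hφ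
  have hinj : Function.Injective φ := smul_left_injective _ hQ0
  have hmap : (piece k (m - 2 - a) (n - 1 - b)).map φ = syzPiece p m n := by
    ext A
    rw [Submodule.mem_map]
    constructor
    · rintro ⟨c, hc, rfl⟩
      refine mem_syzPiece.mpr ⟨?_, fun i => mul_mem_piece hc (hQ i) (by ring) (by ring)⟩
      change (c • Q) ⬝ᵥ p = 0
      rw [smul_dotProduct, hQp, smul_zero]
    · intro hA
      obtain ⟨c, hc, rfl⟩ := h A hA
      exact ⟨c, hc, rfl⟩
  rw [hilbert, ← hmap]
  exact (Submodule.equivMapOfInjective φ hinj _).finrank_eq.symm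

end Hilbert

/-! ### Syzygies of degree `(m, 1)` -/

section LowDegree

variable {k : Type*} [Field k] {F G : Fin 3 → Fin 3 → k}

lemma syzPiece_three_two
    (hprim : IsPrimitiveVec ((fun i => quad (F i)) ⨯₃ fun i => quad (G i))) :
    syzPiece (fun i => form (F i) (G i)) 3 2 = ⊥ := by
  rw [eq_bot_iff]
  intro A hA
  obtain ⟨h1, h2⟩ := mem_syzPiece.mp hA
  norm_num at h2
  exact eq_zero_of_syzygy_three_two (fun i => quad_mem_piece (F i)) (fun i => quad_mem_piece (G i))
    hprim h2 h1

/-- The syzygies of degree `(m, 1)` are orthogonal to both `f` and `g`, hence are multiples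
of `f × g`, which has degree `4` in `x, y`. -/
lemma hilbert_one (hprim : IsPrimitiveVec ((fun i => quad (F i)) ⨯₃ fun i => quad (G i)))
    (m : ℤ) : (hilbert (syzPiece fun i => form (F i) (G i)) m 1 : ℤ) =
      if 6 ≤ m then m - 5 else 0 := by
  set f : Fin 3 → MvPolynomial (Fin 4) k := fun i => quad (F i) with hf
  set g : Fin 3 → MvPolynomial (Fin 4) k := fun i => quad (G i) with hg
  have hform (A : Fin 3 → MvPolynomial (Fin 4) k) :
      (A ⬝ᵥ fun i => form (F i) (G i)) = (A ⬝ᵥ f) * X 2 + (A ⬝ᵥ g) * X 3 := by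
    simp only [dotProduct, Fin.sum_univ_three, form, hf, hg]
    ring
  have hN : ∀ i, (f ⨯₃ g) i ∈ piece k 4 0 :=
    cross_mem_piece (fun i => quad_mem_piece (F i)) (fun i => quad_mem_piece (G i))
      (by norm_num) (by norm_num)
  have hN0 : f ⨯₃ g ≠ 0 := fun h => by
    obtain ⟨j, hj⟩ := hprim.exists_ne_zero
    exact hj (congrFun h j)
  rw [hilbert_of_multiples hN0 (by
    rw [hform, dotProduct_comm _ f, dot_self_cross, dotProduct_comm _ g, dot_cross_self]
    simp) hN]
  · split_ifs with hm
    · rw [finrank_piece (by omega) (by norm_num)]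
      ring
    · rw [piece_eq_bot (by omega), finrank_bot]
      rfl
  · intro A hA
    obtain ⟨h1, h2⟩ := mem_syzPiece.mp hA
    rw [hform] at h1
    rw [sub_self] at h2
    obtain ⟨h3, h4⟩ := eq_zero_of_linear_zw (m := m - 2 + 2)
      (dotProduct_mem_piece h2 (fun i => quad_mem_piece (F i)) rfl (by norm_num))
      (dotProduct_mem_piece h2 (fun i => quad_mem_piece (G i)) rfl (by norm_num)) h1
    simpa using exists_eq_smul_cross hprim h3 h4 hN h2

end LowDegree

/-! ### Syzygies of degree `(2, n)` -/

section DegreeTwo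

variable {k : Type*} [Field k] {F G : Matrix (Fin 3) (Fin 3) k}

/-- The vectors of linear forms in `z, w` which are the coefficients of `x²`, `xy`, `y²` in
`p₀, p₁, p₂`. -/
noncomputable def col (F G : Matrix (Fin 3) (Fin 3) k) (j i : Fin 3) : MvPolynomial (Fin 4) k :=
  C (F i j) * X 2 + C (G i j) * X 3

lemma linear_mem_piece (r s : k) :
    (C r * X 2 + C s * X 3 : MvPolynomial (Fin 4) k) ∈ piece k 0 1 :=
  add_mem (C_mul_mem_piece _ X_two_mem_piece) (C_mul_mem_piece _ X_three_mem_piece)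

lemma exists_eq_linear {P : MvPolynomial (Fin 4) k} (hP : P ∈ piece k 0 1) :
    ∃ r s : k, P = C r * X 2 + C s * X 3 := by
  obtain ⟨q, hq, q', hq', rfl⟩ := exists_eq_mul_z_add_mul_w (by norm_num) hP
  norm_num at hq hq'
  obtain ⟨r, rfl⟩ := exists_eq_C hq
  obtain ⟨s, rfl⟩ := exists_eq_C hq'
  exact ⟨r, s, rfl⟩

lemma col_mem_piece (j i : Fin 3) : col F G j i ∈ piece k 0 1 := linear_mem_piece _ _

lemma dotProduct_form (A : Fin 3 → MvPolynomial (Fin 4) k) :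
    (A ⬝ᵥ fun i => form (F i) (G i)) = (A ⬝ᵥ col F G 0) * X 0 ^ 2 +
      (A ⬝ᵥ col F G 1) * (X 0 * X 1) + (A ⬝ᵥ col F G 2) * X 1 ^ 2 := by
  simp only [dotProduct, Fin.sum_univ_three, form, quad, col]
  ring

lemma dotProduct_form_eq_zero {A : Fin 3 → MvPolynomial (Fin 4) k}
    (h : ∀ j, A ⬝ᵥ col F G j = 0) : (A ⬝ᵥ fun i => form (F i) (G i)) = 0 := by
  rw [dotProduct_form, h, h, h]
  ring

lemma dotProduct_col_eq_zero {n : ℤ} {A : Fin 3 → MvPolynomial (Fin 4) k}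
    (hA : ∀ i, A i ∈ piece k 0 n) (h : (A ⬝ᵥ fun i => form (F i) (G i)) = 0) (j : Fin 3) :
    A ⬝ᵥ col F G j = 0 := by
  have hm (j : Fin 3) : A ⬝ᵥ col F G j ∈ piece k 0 (n + 1) :=
    dotProduct_mem_piece hA (col_mem_piece j) (by norm_num) rfl
  rw [dotProduct_form] at h
  obtain ⟨h0, h1, h2⟩ := eq_zero_of_quadratic_xy (hm 0) (hm 1) (hm 2) h
  fin_cases j
  exacts [h0, h1, h2]

/-- The determinant, a binary cubic form in `z, w`, of the matrix of linear forms whose rows are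
the coefficients of `p₀, p₁, p₂` at `x²`, `xy`, `y²`. -/
noncomputable def cubic (F G : Matrix (Fin 3) (Fin 3) k) : MvPolynomial (Fin 4) k :=
  col F G 0 ⬝ᵥ col F G 1 ⨯₃ col F G 2

/-- A syzygy of degree `(2, n)` is a vector over `k[z, w]` orthogonal to the three columns. -/
lemma hilbert_two_of_cubic_ne_zero (hD : cubic F G ≠ 0) (n : ℤ) :
    hilbert (syzPiece fun i => form (F i) (G i)) 2 n = 0 := by
  refine hilbert_eq_zero (eq_bot_iff.mpr fun A hA => ?_)
  obtain ⟨h1, h2⟩ := mem_syzPiece.mp hA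
  rw [sub_self] at h2
  have h := dotProduct_col_eq_zero h2 h1
  have hpar := mul_eq_mul_of_cross_eq_zero (cross_cross_eq_zero (h 1) (h 2))
  funext i
  refine mul_right_cancel₀ hD ?_
  have h0 := h 0
  rw [dotProduct, Fin.sum_univ_three] at h0
  rw [Pi.zero_apply, zero_mul, cubic, dotProduct, Fin.sum_univ_three]
  linear_combination col F G 0 0 * hpar i 0 + col F G 0 1 * hpar i 1 + col F G 0 2 * hpar i 2 +
    (col F G 1 ⨯₃ col F G 2) i * h0

/-- Multiplying by `x` reduces to the absence of syzygies of degree `(3, 2)`. -/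
lemma eq_zero_of_linear_syzygy (hS : syzPiece (fun i => form (F i) (G i)) 3 2 = ⊥)
    {A : Fin 3 → MvPolynomial (Fin 4) k} (hA : ∀ i, A i ∈ piece k 0 1)
    (h : (A ⬝ᵥ fun i => form (F i) (G i)) = 0) : A = 0 := by
  have hmem : (X 0 : MvPolynomial (Fin 4) k) • A ∈ syzPiece (fun i => form (F i) (G i)) 3 2 := by
    refine mem_syzPiece.mpr ⟨?_, fun i =>
      mul_mem_piece X_zero_mem_piece (hA i) (by norm_num) (by norm_num)⟩
    rw [smul_dotProduct, h, smul_zero]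
  rw [hS, Submodule.mem_bot] at hmem
  exact (smul_eq_zero.mp hmem).resolve_left (X_ne_zero 0)

lemma eq_zero_of_constant_syzygy (hS : syzPiece (fun i => form (F i) (G i)) 3 2 = ⊥)
    {u : Fin 3 → k} (h : ((fun i => C (u i)) ⬝ᵥ fun i => form (F i) (G i)) = 0) : u = 0 := by
  have := eq_zero_of_linear_syzygy hS (A := (X 2 : MvPolynomial (Fin 4) k) • fun i => C (u i))
    (fun i => by
      rw [Pi.smul_apply, smul_eq_mul, mul_comm]
      exact C_mul_mem_piece _ X_two_mem_piece)
    (by rw [smul_dotProduct, h, smul_zero])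
  have := (smul_eq_zero.mp this).resolve_left (X_ne_zero 2)
  funext i
  simpa using congrFun this i

/-- If all the cross products vanished, the matrix of linear forms would have rank at most one,
and `e × cⱼ` would be a syzygy with linear entries, for each constant vector `e` and each column
`cⱼ`. -/
lemma exists_cross_col_ne_zero (hS : syzPiece (fun i => form (F i) (G i)) 3 2 = ⊥) :
    ∃ j l, col F G j ⨯₃ col F G l ≠ 0 := by
  by_contra! hall
  have hlin (u : Fin 3 → k) (j : Fin 3) : (fun i => C (u i)) ⨯₃ col F G j = 0 := by
    refine eq_zero_of_linear_syzygy hS (cross_mem_piece (a := 0) (b := 0)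
      (fun i => isWeightedHomogeneous_C _ _) (col_mem_piece j) (by norm_num) (by norm_num))
      (dotProduct_form_eq_zero fun l => ?_)
    rw [dotProduct_comm, triple_product_permutation, hall, dotProduct_zero]
  have hcol (j : Fin 3) : col F G j = 0 := by
    have h0 := hlin ![1, 0, 0] j
    have h1 := hlin ![0, 1, 0] j
    rw [cross_apply] at h0 h1
    have h01 := congrFun h0 1
    have h02 := congrFun h0 2
    have h12 := congrFun h1 0
    simp at h01 h02 h12
    funext i
    fin_cases i
    exacts [by simpa using congrFun h1 2, h02, h01]
  have := eq_zero_of_constant_syzygy hS (u := fun _ => 1)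
    (dotProduct_form_eq_zero fun j => by rw [hcol, dotProduct_zero])
  exact one_ne_zero (congrFun this 0)

lemma exists_eq_quadratic_zw {P : MvPolynomial (Fin 4) k} (hP : P ∈ piece k 0 2) :
    ∃ a b c : k, P = C a * X 2 ^ 2 + C b * (X 2 * X 3) + C c * X 3 ^ 2 := by
  obtain ⟨Q, hQ, S, hS, rfl⟩ := exists_eq_mul_z_add_mul_w (by norm_num) hP
  obtain ⟨a, b, rfl⟩ := exists_eq_linear hQ
  obtain ⟨c, d, rfl⟩ := exists_eq_linear hS
  refine ⟨a, b + c, d, ?_⟩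
  simp
  ring

/-- A binary quadratic form vanishing at `(s : t)` is divisible by the linear form `t z - s w`. -/
lemma exists_factor_of_zero {a b c s t : k} (hst : ¬ (s = 0 ∧ t = 0))
    (h : a * s ^ 2 + b * (s * t) + c * t ^ 2 = 0) :
    ∃ d e : k, a = d * t ∧ b = e * t - d * s ∧ c = -(e * s) := by
  rcases eq_or_ne s 0 with rfl | hs
  · have ht : t ≠ 0 := fun ht => hst ⟨rfl, ht⟩
    refine ⟨a / t, b / t, by field_simp, by field_simp; ring, ?_⟩
    simpa [ht] using h
  · refine ⟨(-c / s * t - b) / s, -c / s, ?_, by field_simp; ring, by field_simp⟩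
    field_simp
    linear_combination h

/-- If the entries of `B` all vanished at `(s : t)`, dividing them by `t z - s w` would give a
syzygy with linear entries. -/
lemma isPrimitiveVec_of_quadratic_syzygy [IsAlgClosed k]
    (hS : syzPiece (fun i => form (F i) (G i)) 3 2 = ⊥) {B : Fin 3 → MvPolynomial (Fin 4) k}
    (hB : ∀ i, B i ∈ piece k 0 2) (hB0 : B ≠ 0)
    (h : (B ⬝ᵥ fun i => form (F i) (G i)) = 0) : IsPrimitiveVec B := by
  refine isPrimitiveVec_of_zeros (a := 2) (b := 3) (by decide) fun pt hpt => ?_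
  by_contra hne
  choose a b c habc using fun i => exists_eq_quadratic_zw (hB i)
  choose d e h1 h2 h3 using fun i => exists_factor_of_zero (a := a i) (b := b i) (c := c i) hne
    (by simpa [habc] using hpt i)
  have hfac : B = (C (pt 3) * X 2 - C (pt 2) * X 3 : MvPolynomial (Fin 4) k) •
      fun i => C (d i) * X 2 + C (e i) * X 3 := by
    funext i
    rw [habc, h1, h2, h3]
    simp only [Pi.smul_apply, smul_eq_mul, map_mul, map_sub, map_neg]
    ring
  have hl : (C (pt 3) * X 2 - C (pt 2) * X 3 : MvPolynomial (Fin 4) k) ≠ 0 := fun hl =>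
    hB0 (by rw [hfac, hl, zero_smul])
  rw [hfac, smul_dotProduct] at h
  refine hB0 ?_
  rw [hfac, eq_zero_of_linear_syzygy hS (fun i => linear_mem_piece (d i) (e i))
    ((smul_eq_zero.mp h).resolve_left hl), smul_zero]

/-- If the determinant vanishes then so does every triple product of columns, repetitions
included. -/
lemma dotProduct_cross_col (hD : cubic F G = 0) (j l m : Fin 3) :
    col F G j ⬝ᵥ col F G l ⨯₃ col F G m = 0 := by
  have hD' := hD
  simp only [cubic, cross_apply, dotProduct, Fin.sum_univ_three, Matrix.cons_val] at hD' ⊢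
  fin_cases j <;> fin_cases l <;> fin_cases m <;> dsimp only [Fin.mk_one, Fin.zero_eta,
    Fin.reduceFinMk] <;> first | ring1 | linear_combination hD' | linear_combination -hD'

/-- If the cubic vanishes, the syzygies of degree `(2, n)` are the multiples of a nonzero
cross product of two columns, whose entries are quadratic. -/
lemma hilbert_two_of_cubic_eq_zero [IsAlgClosed k]
    (hS : syzPiece (fun i => form (F i) (G i)) 3 2 = ⊥) (hD : cubic F G = 0) (n : ℤ) :
    (hilbert (syzPiece fun i => form (F i) (G i)) 2 n : ℤ) = if 3 ≤ n then n - 2 else 0 := by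
  obtain ⟨j, l, hB0⟩ := exists_cross_col_ne_zero hS
  have hB : ∀ i, (col F G j ⨯₃ col F G l) i ∈ piece k 0 2 :=
    cross_mem_piece (col_mem_piece j) (col_mem_piece l) (by norm_num) (by norm_num)
  have hBp : ((col F G j ⨯₃ col F G l) ⬝ᵥ fun i => form (F i) (G i)) = 0 :=
    dotProduct_form_eq_zero fun m => by rw [dotProduct_comm, dotProduct_cross_col hD]
  rw [hilbert_of_multiples hB0 hBp hB]
  · split_ifs with hn
    · rw [finrank_piece (by norm_num) (by omega)]
      ring
    · rw [piece_eq_bot (by omega), finrank_bot]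
      rfl
  · intro A hA
    obtain ⟨h1, h2⟩ := mem_syzPiece.mp hA
    have h2' := h2
    rw [sub_self] at h2'
    have h := dotProduct_col_eq_zero h2' h1
    exact exists_eq_smul_cross (isPrimitiveVec_of_quadratic_syzygy hS hB hB0 hBp) (h j) (h l) hB h2

end DegreeTwo

/-! ### Genericity and the determinantal cubic -/

section Generic

variable {k : Type*} [Field k] {F G : Matrix (Fin 3) (Fin 3) k}

lemma eval_cubic (pt : Fin 4 → k) : eval pt (cubic F G) = (pt 2 • F + pt 3 • G).det := by
  simp [cubic, col, det_fin_three, cross_apply, dotProduct, Fin.sum_univ_three]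
  ring

lemma sum_smul_form (u : Fin 3 → k) :
    ∑ i, u i • form (F i) (G i) = form (u ᵥ* F) (u ᵥ* G) := by
  simp only [form, quad, vecMul, dotProduct, Fin.sum_univ_three, smul_eq_C_mul, map_add, map_mul]
  ring

lemma form_vecMul_ne_zero (hS : syzPiece (fun i => form (F i) (G i)) 3 2 = ⊥) {u : Fin 3 → k}
    (hu : u ≠ 0) : form (u ᵥ* F) (u ᵥ* G) ≠ 0 := by
  intro h
  refine hu (eq_zero_of_constant_syzygy hS ?_)
  rw [← h, ← sum_smul_form]
  simp [dotProduct, smul_eq_C_mul]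

lemma form_mem_span (u : Fin 3 → k) :
    form (u ᵥ* F) (u ᵥ* G) ∈ Submodule.span k (Set.range fun i => form (F i) (G i)) := by
  rw [← sum_smul_form]
  exact Submodule.mem_span_range_iff_exists_fun k |>.mpr ⟨u, rfl⟩

/-- If the cubic vanishes, then for every `t` the three forms restricted to `(z : w) = (1 : t)` are
linearly dependent, so that some combination of them is divisible by `w - t z`. -/
lemma infinite_of_cubic_eq_zero [Infinite k]
    (hS : syzPiece (fun i => form (F i) (G i)) 3 2 = ⊥) (hD : cubic F G = 0) :
    (planeW (fun i => form (F i) (G i)) ∩ segreY k).Infinite := by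
  have hker (t : k) : ∃ u ≠ 0, u ᵥ* (F + t • G) = 0 := by
    rw [exists_vecMul_eq_zero_iff]
    simpa [hD] using (eval_cubic (F := F) (G := G) ![0, 0, 1, t]).symm
  choose u hu0 hu using hker
  have hF (t : k) : u t ᵥ* F = -t • (u t ᵥ* G) := by
    have := hu t
    rw [vecMul_add, vecMul_smul] at this
    rw [neg_smul]
    exact eq_neg_of_add_eq_zero_left this
  have hform (t : k) : form (u t ᵥ* F) (u t ᵥ* G) =
      quad (u t ᵥ* G) * (C (-t) * X 2 + C 1 * X 3) := by
    rw [hF]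
    simp [form, quad]
    ring
  have hne (t : k) : (⟨_, form_mem_piece (u t ᵥ* F) (u t ᵥ* G)⟩ : piece k 2 1) ≠ 0 := fun h =>
    form_vecMul_ne_zero hS (hu0 t) (congrArg Subtype.val h)
  refine Set.infinite_of_injective_forall_mem
    (f := fun t => Projectivization.mk k _ (hne t)) ?_ fun t => ?_
  · intro s t hst
    rw [Projectivization.mk_eq_mk_iff'] at hst
    obtain ⟨a, ha⟩ := hst
    have ha' : a • form (u t ᵥ* F) (u t ᵥ* G) = form (u s ᵥ* F) (u s ᵥ* G) :=
      congrArg Subtype.val ha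
    rw [hform, hform, ← sub_eq_zero] at ha'
    have hlin : (C (-a * t) * quad (u t ᵥ* G) + C s * quad (u s ᵥ* G)) * X 2 +
        (C a * quad (u t ᵥ* G) + C (-1) * quad (u s ᵥ* G)) * X 3 = 0 := by
      rw [← ha']
      simp only [smul_eq_C_mul, map_neg, map_mul, map_one]
      ring
    obtain ⟨h1, h2⟩ := eq_zero_of_linear_zw
      (add_mem (C_mul_mem_piece _ (quad_mem_piece _)) (C_mul_mem_piece _ (quad_mem_piece _)))
      (add_mem (C_mul_mem_piece _ (quad_mem_piece _)) (C_mul_mem_piece _ (quad_mem_piece _))) hlin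
    have h3 : C (s - t) * quad (u s ᵥ* G) = 0 := by
      simp only [map_neg, map_mul, map_one, map_sub] at h1 h2 ⊢
      linear_combination h1 + C t * h2
    rcases mul_eq_zero.mp h3 with h | h
    · exact sub_eq_zero.mp (C_eq_zero.mp h)
    · refine absurd ?_ (form_vecMul_ne_zero hS (hu0 s))
      rw [hform, h, zero_mul]
  · obtain ⟨a, ha⟩ := Projectivization.exists_smul_eq_mk_rep k _ (hne t)
    have ha' : a • form (u t ᵥ* F) (u t ᵥ* G) =
      ((Projectivization.mk k _ (hne t)).rep : MvPolynomial (Fin 4) k) := congrArg Subtype.val ha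
    refine ⟨?_, a • quad (u t ᵥ* G), Submodule.smul_mem _ _ (quad_mem_piece _), _,
      linear_mem_piece (-t) 1, ?_⟩
    · change _ ∈ Submodule.span k _
      rw [← ha']
      exact Submodule.smul_mem _ _ (form_mem_span _)
    · rw [← ha', hform, smul_mul_assoc]

/-- A binary quadratic form over an algebraically closed field has a nontrivial zero. -/
lemma exists_zero_quadratic [IsAlgClosed k] (a b c : k) :
    ∃ v : Fin 2 → k, v ≠ 0 ∧ a * v 0 ^ 2 + b * (v 0 * v 1) + c * v 1 ^ 2 = 0 := by
  rcases eq_or_ne a 0 with rfl | ha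
  · exact ⟨![1, 0], fun h => one_ne_zero (congrFun h 0), by simp⟩
  · obtain ⟨r, hr⟩ := IsAlgClosed.exists_root
      (Polynomial.C a * Polynomial.X ^ 2 + Polynomial.C b * Polynomial.X + Polynomial.C c)
      (by rw [Polynomial.degree_quadratic ha]; decide)
    refine ⟨![r, 1], fun h => one_ne_zero (congrFun h 1), ?_⟩
    simpa using hr

/-- The combinations of `p₀, p₁, p₂` vanishing identically at a point `(s : t)` are proportional:
two independent ones would force the restrictions of `p₀, p₁, p₂` to be multiples of a single
quadratic form, whose zeros would be common zeros. -/
lemma proportional_of_vecMul_eq_zero [IsAlgClosed k]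
    (hzero : NoCommonZeros fun i => form (F i) (G i)) {s t : k} (hst : ![s, t] ≠ 0)
    {u u' : Fin 3 → k} (hu : u ᵥ* (s • F + t • G) = 0) (hu' : u' ᵥ* (s • F + t • G) = 0)
    (hu0 : u ≠ 0) : ∃ a : k, a • u = u' := by
  by_contra! hne
  have hN : u ⨯₃ u' ≠ 0 := by
    rw [crossProduct_ne_zero_iff_linearIndependent, LinearIndependent.pair_iff' hu0]
    exact hne
  obtain ⟨l, hl⟩ := Function.ne_iff.mp hN
  rw [Pi.zero_apply] at hl
  set M := s • F + t • G with hM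
  have hpar (i j : Fin 3) : M i j * (u ⨯₃ u') l = M l j * (u ⨯₃ u') i := by
    refine mul_eq_mul_of_cross_eq_zero (A := fun i => M i j) (cross_cross_eq_zero ?_ ?_) i l
    · rw [dotProduct_comm]
      exact congrFun hu j
    · rw [dotProduct_comm]
      exact congrFun hu' j
  obtain ⟨v, hv0, hv⟩ := exists_zero_quadratic (M l 0) (M l 1) (M l 2)
  obtain ⟨i, hi⟩ := hzero v ![s, t] hv0 hst
  refine hi ((mul_eq_zero.mp ?_).resolve_right hl)
  have hev : eval ![v 0, v 1, ![s, t] 0, ![s, t] 1] (form (F i) (G i)) =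
      M i 0 * v 0 ^ 2 + M i 1 * (v 0 * v 1) + M i 2 * v 1 ^ 2 := by
    rw [eval_form]
    simp [hM]
    ring
  rw [hev]
  linear_combination v 0 ^ 2 * hpar i 0 + v 0 * v 1 * hpar i 1 + v 1 ^ 2 * hpar i 2 +
    (u ⨯₃ u') i * hv

/-- The points of `W(p)` represented by a combination vanishing identically at `(s : t)`. -/
def vanishingAt (F G : Matrix (Fin 3) (Fin 3) k) (s t : k) : Set (ℙ k (piece k 2 1)) :=
  {P | ∃ u : Fin 3 → k, (P.rep : MvPolynomial (Fin 4) k) = form (u ᵥ* F) (u ᵥ* G) ∧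
    u ᵥ* (s • F + t • G) = 0}

lemma ne_zero_of_rep_eq_form {P : ℙ k (piece k 2 1)} {u : Fin 3 → k}
    (h : (P.rep : MvPolynomial (Fin 4) k) = form (u ᵥ* F) (u ᵥ* G)) : u ≠ 0 := by
  rintro rfl
  apply P.rep_nonzero
  rw [zero_vecMul, zero_vecMul] at h
  exact Subtype.ext (by simpa [form, quad] using h)

lemma subsingleton_vanishingAt [IsAlgClosed k]
    (hzero : NoCommonZeros fun i => form (F i) (G i)) {s t : k} (hst : ![s, t] ≠ 0) :
    (vanishingAt F G s t).Subsingleton := by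
  rintro P ⟨u, hP, hu⟩ P' ⟨u', hP', hu'⟩
  obtain ⟨a, rfl⟩ := proportional_of_vecMul_eq_zero hzero hst hu' hu (ne_zero_of_rep_eq_form hP')
  rw [← P.mk_rep, ← P'.mk_rep, Projectivization.mk_eq_mk_iff']
  refine ⟨a, Subtype.ext ?_⟩
  rw [Submodule.coe_smul, hP, hP', ← sum_smul_form, ← sum_smul_form, Finset.smul_sum]
  simp [mul_smul]

/-- A decomposable element `q (r z + s w)` of `W(p)` vanishes identically at `(s : -r)`. -/
lemma exists_mem_vanishingAt {P : ℙ k (piece k 2 1)}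
    (hP : P ∈ planeW (fun i => form (F i) (G i)) ∩ segreY k) :
    P ∈ vanishingAt F G 0 1 ∨ ∃ t, P ∈ vanishingAt F G 1 t := by
  obtain ⟨hW, q, hq, l, hl, hql⟩ := hP
  obtain ⟨u, hu⟩ := Submodule.mem_span_range_iff_exists_fun k |>.mp hW
  rw [sum_smul_form] at hu
  obtain ⟨Q, rfl⟩ := exists_eq_quad hq
  obtain ⟨r, s, rfl⟩ := exists_eq_linear hl
  have hlin : (quad (u ᵥ* F) + C (-r) * quad Q) * X 2 +
      (quad (u ᵥ* G) + C (-s) * quad Q) * X 3 = 0 := by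
    have := hu.trans hql
    rw [form] at this
    simp only [map_neg]
    linear_combination this
  obtain ⟨h1, h2⟩ := eq_zero_of_linear_zw
    (add_mem (quad_mem_piece _) (C_mul_mem_piece _ (quad_mem_piece _)))
    (add_mem (quad_mem_piece _) (C_mul_mem_piece _ (quad_mem_piece _))) hlin
  have hquad (a b : k) (hab : a * r + b * s = 0) : u ᵥ* (a • F + b • G) = 0 := by
    rw [← quad_eq_zero_iff, vecMul_add, vecMul_smul, vecMul_smul]
    have e : quad (a • (u ᵥ* F) + b • (u ᵥ* G)) =
        C a * quad (u ᵥ* F) + C b * quad (u ᵥ* G) := by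
      simp [quad]
      ring
    have hab' : (C a * C r + C b * C s : MvPolynomial (Fin 4) k) = 0 := by
      rw [← C_mul, ← C_mul, ← C_add, hab, C_0]
    rw [e]
    simp only [map_neg] at h1 h2
    linear_combination C a * h1 + C b * h2 + quad Q * hab'
  rcases eq_or_ne s 0 with rfl | hs
  · exact Or.inl ⟨u, hu.symm, hquad _ _ (by simp)⟩
  · exact Or.inr ⟨-r / s, u, hu.symm, hquad _ _ (by field_simp; ring)⟩

/-- The cubic has finitely many zeros of the form `(1 : t)` unless it is zero: being homogeneous,
it is determined off `z = 0` by its values at these points. -/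
lemma finite_setOf_det_eq_zero [Infinite k] (hD : cubic F G ≠ 0) :
    {t : k | (F + t • G).det = 0}.Finite := by
  by_contra hinf
  set δ : Polynomial k := aeval ![0, 0, 1, Polynomial.X] (cubic F G) with hδ
  have heval (t : k) : δ.eval t = (F + t • G).det := by
    have h := eval_cubic (F := F) (G := G) ![0, 0, 1, t]
    simp only [Matrix.cons_val, one_smul] at h
    rw [← h, hδ, ← Polynomial.coe_aeval_eq_eval, comp_aeval_apply]
    have hpt : (fun i => Polynomial.aeval t ((![0, 0, 1, Polynomial.X] : Fin 4 → Polynomial k) i)) =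
        ![0, 0, 1, t] := by
      funext i
      fin_cases i <;> simp
    rw [hpt]
    rfl
  have hδ0 : δ = 0 := Polynomial.eq_zero_of_infinite_isRoot δ
    (Set.Infinite.mono (fun t ht => (heval t).trans ht) hinf)
  -- The factor `z` takes care of the points with `z = 0`.
  have hX : X 2 * cubic F G = 0 := by
    refine MvPolynomial.funext fun pt => ?_
    rw [map_mul, eval_X, eval_cubic, map_zero]
    rcases eq_or_ne (pt 2) 0 with h | h
    · rw [h, zero_mul]
    · have : pt 2 • F + pt 3 • G = pt 2 • (F + (pt 3 / pt 2) • G) := by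
        rw [smul_add, smul_smul, mul_div_cancel₀ _ h]
      rw [this, det_smul, ← heval, hδ0]
      simp
  exact hD ((mul_eq_zero.mp hX).resolve_left (X_ne_zero 2))

lemma finite_of_cubic_ne_zero [IsAlgClosed k]
    (hzero : NoCommonZeros fun i => form (F i) (G i)) (hD : cubic F G ≠ 0) :
    (planeW (fun i => form (F i) (G i)) ∩ segreY k).Finite := by
  have hinf : Infinite k := IsAlgClosed.instInfinite
  refine (Set.Finite.union (subsingleton_vanishingAt hzero (s := 0) (t := 1)
    fun h => one_ne_zero (congrFun h 1)).finite
    (Set.Finite.biUnion (finite_setOf_det_eq_zero hD) fun t _ =>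
    (subsingleton_vanishingAt hzero (s := 1) (t := t)
    fun h => one_ne_zero (congrFun h 0)).finite)).subset fun P hP => ?_
  rcases exists_mem_vanishingAt hP with h | ⟨t, h⟩
  · exact Or.inl h
  · refine Or.inr (Set.mem_biUnion (x := t) ?_ h)
    obtain ⟨u, hu, hu'⟩ := h
    rw [one_smul] at hu'
    exact exists_vecMul_eq_zero_iff.mp ⟨u, ne_zero_of_rep_eq_form hu, hu'⟩

end Generic

end BigradedSyzygy

theorem proposition5p1 {k : Type*} [Field k] [IsAlgClosed k]
    (p : Fin 3 → MvPolynomial (Fin 4) k)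
    (hp : ∀ i, p i ∈ BigradedSyzygy.piece k 2 1)
    (hzero : BigradedSyzygy.NoCommonZeros p) :
    (∀ m n : ℤ, Module.Finite k (BigradedSyzygy.syzPiece p m n)) ∧
    (BigradedSyzygy.IsGeneric p → ∀ m n : ℤ,
      (BigradedSyzygy.hilbert (BigradedSyzygy.syzPiece p) m n : ℤ) =
        if 5 ≤ m ∧ 2 ≤ n then 3 * (m - 3) * (n - 1) - (m - 5) * (n - 2)
        else if 6 ≤ m ∧ n = 1 then m - 5
        else if m = 3 ∧ 3 ≤ n then 2 * (n - 2)
        else if m = 4 ∧ 2 ≤ n then 3 * (n - 1) + (n - 2)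
        else 0) ∧
    (BigradedSyzygy.IsNonGeneric p → ∀ m n : ℤ,
      (BigradedSyzygy.hilbert (BigradedSyzygy.syzPiece p) m n : ℤ) =
        if 5 ≤ m ∧ 2 ≤ n then 3 * (m - 3) * (n - 1) - (m - 5) * (n - 2)
        else if 6 ≤ m ∧ n = 1 then m - 5
        else if (m = 2 ∨ m = 3) ∧ 3 ≤ n then (m - 1) * (n - 2)
        else if m = 4 ∧ 2 ≤ n then 3 * (n - 1) + (n - 2)
        else 0) := by
  open BigradedSyzygy in
  have hinf : Infinite k := IsAlgClosed.instInfinite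
  choose F G hFG using fun i => exists_eq_form (hp i)
  obtain rfl : p = fun i => form (F i) (G i) := funext hFG
  have hprim := isPrimitiveVec_cross_quad hzero
  have hS := syzPiece_three_two hprim
  have hneg {m n : ℤ} (h : m < 2 ∨ n < 1) :
      hilbert (syzPiece fun i => form (F i) (G i)) m n = 0 :=
    hilbert_eq_zero (syzPiece_eq_bot_of_neg h)
  have hone := hilbert_one hprim
  have hlarge {m n : ℤ} := hilbert_of_three_le (m := m) (n := n) hp hS
  refine ⟨finite_syzPiece, fun hgen m n => ?_, fun hgen m n => ?_⟩
  · have htwo := hilbert_two_of_cubic_ne_zero (F := F) (G := G)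
      (fun hD => infinite_of_cubic_eq_zero hS hD hgen)
    rcases lt_or_ge n 1 with hn | hn
    · rw [hneg (Or.inr hn)]
      split_ifs <;> omega
    rcases lt_or_ge m 2 with hm | hm
    · rw [hneg (Or.inl hm)]
      split_ifs <;> omega
    rcases hn.eq_or_lt with rfl | hn
    · rw [hone]
      split_ifs <;> omega
    rcases hm.eq_or_lt with rfl | hm
    · rw [htwo]
      split_ifs <;> omega
    · rw [hlarge (by omega) (by omega)]
      obtain rfl | rfl | hm : m = 3 ∨ m = 4 ∨ 5 ≤ m := by omega
      · split_ifs <;> omega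
      · split_ifs <;> omega
      · rw [if_pos ⟨hm, by omega⟩]
        ring
  · have hD : cubic F G = 0 := by
      by_contra hD
      exact hgen (finite_of_cubic_ne_zero hzero hD)
    have htwo := hilbert_two_of_cubic_eq_zero hS hD
    rcases lt_or_ge n 1 with hn | hn
    · rw [hneg (Or.inr hn)]
      split_ifs <;> omega
    rcases lt_or_ge m 2 with hm | hm
    · rw [hneg (Or.inl hm)]
      split_ifs <;> omega
    rcases hn.eq_or_lt with rfl | hn
    · rw [hone]
      split_ifs <;> omega
    rcases hm.eq_or_lt with rfl | hm
    · rw [htwo]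
      split_ifs <;> omega
    · rw [hlarge (by omega) (by omega)]
      obtain rfl | rfl | hm : m = 3 ∨ m = 4 ∨ 5 ≤ m := by omega
      · split_ifs <;> omega
      · split_ifs <;> omega
      · rw [if_pos ⟨hm, by omega⟩]
        ring
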